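/- Encode a binary string $w=w_1\dots w_n$ ($n\ge 1$) as the finite structure over the vocabulary $\langle <, S;\ \mathsf{min},\mathsf{max}\rangle$ with universe $\{1,\dots,n\}$, where $<$ is the natural order, $S=\{i : w_i=1\}$, and the constants $\mathsf{min},\mathsf{max}$ denote $1$ and $n$. A first-order sentence $\varphi$ (with equality) over this vocabulary separates $(\{w\},\{w'\})$ if $w\models\varphi$ and $w'\not\models\varphi$; its number of quantifiers is the number of occurrences of $\exists$ and $\forall$ in it. Logarithms are to base $2$. (Upper bound.) There is an absolute constant $C$ such that for every $n\ge 1$ and all $n$-bit strings $w\neq w'$ there is a sentence in prenex normal form that separates $(\{w\},\{w'\})$, has at most $\log n + C$ quantifiers, and whose quantifier prefix strictly alternates between $\exists$ and $\forall$ and ends with $\forall$. (Lower bound.) For all sufficiently large $n$ there exist two distinct $n$-bit strings $w, w'$ such that every first-order sentence (prenex or not) separating $(\{w\},\{w'\})$ has at least $\lfloor\log n\rfloor$ quantifiers. -/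

import Mathlib

/-- Function symbols of the vocabulary of binary strings: two constant symbols. -/
inductive StringFunc : ℕ → Type
  | min : StringFunc 0
  | max : StringFunc 0

/-- Relation symbols of the vocabulary of binary strings: a unary and a binary predicate. -/
inductive StringRel : ℕ → Type
  | S : StringRel 1
  | lt : StringRel 2

/-- The vocabulary `⟨<, S ; min, max⟩` of binary strings. -/
def tauString : FirstOrder.Language.{0, 0} := ⟨StringFunc, StringRel⟩

/-- The structure encoding the nonempty string `w`: the universe is the set of the `n` positions
(indexed from `0` to `n - 1`), `<` is their natural order, `S` holds at the positions carrying the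
bit `1`, and `min` and `max` are the first and the last position. -/
@[reducible]
def stringStructure {n : ℕ} [NeZero n] (w : Fin n → Bool) : tauString.Structure (Fin n) where
  funMap := fun {_} f => match f with
    | StringFunc.min => fun _ => ⟨0, Nat.pos_of_ne_zero (NeZero.ne n)⟩
    | StringFunc.max => fun _ => ⟨n - 1, Nat.sub_one_lt (NeZero.ne n)⟩
  RelMap := fun {_} r => match r with
    | StringRel.S => fun x => w (x 0) = true
    | StringRel.lt => fun x => x 0 < x 1

/-- The string `w` satisfies the first-order sentence `φ`. -/
def StringSat {n : ℕ} [NeZero n] (w : Fin n → Bool) (φ : tauString.Sentence) : Prop :=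
  @FirstOrder.Language.Sentence.Realize tauString (Fin n) (stringStructure w) φ

/-- The sentence `φ` separates `(A, B)`: true on every string in `A`, false on every one in `B`. -/
def Separates {n : ℕ} [NeZero n] (φ : tauString.Sentence) (A B : Set (Fin n → Bool)) : Prop :=
  (∀ w ∈ A, StringSat w φ) ∧ (∀ w ∈ B, ¬ StringSat w φ)

/-- The number of occurrences of quantifiers in a formula. (An existential quantifier is
`¬ ∀ ¬`, hence counted once.) -/
def numQuantifiers {L : FirstOrder.Language.{0, 0}} {α : Type} :
    {k : ℕ} → L.BoundedFormula α k → ℕ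
  | _, .falsum => 0
  | _, .equal _ _ => 0
  | _, .rel _ _ => 0
  | _, .imp φ ψ => numQuantifiers φ + numQuantifiers ψ
  | _, .all φ => numQuantifiers φ + 1

/-- The two quantifiers. -/
inductive Quantifier : Type
  | ex : Quantifier
  | all : Quantifier

/-- `HasSignature φ Q`: the formula `φ` is in prenex normal form, and its quantifier prefix, read
from the outside in, is `Q`. -/
inductive HasSignature {L : FirstOrder.Language.{0, 0}} {α : Type} :
    {k : ℕ} → L.BoundedFormula α k → List Quantifier → Prop
  | qf {k : ℕ} {φ : L.BoundedFormula α k} (h : φ.IsQF) : HasSignature φ []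
  | ex {k : ℕ} {φ : L.BoundedFormula α (k + 1)} {Q : List Quantifier} (h : HasSignature φ Q) :
      HasSignature φ.ex (Quantifier.ex :: Q)
  | all {k : ℕ} {φ : L.BoundedFormula α (k + 1)} {Q : List Quantifier} (h : HasSignature φ Q) :
      HasSignature φ.all (Quantifier.all :: Q)

/-- The signature strictly alternates, is nonempty, and its last quantifier is `∀`. -/
def AlternatingEndingInForall (Q : List Quantifier) : Prop :=
  Q.IsChain (· ≠ ·) ∧ Q.getLast? = some Quantifier.all

/-! Lower bound: two strings with a single `1`, at positions `2 ^ r - 1` and `2 ^ r` with `r + 1 =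
⌊log n⌋`, are indistinguishable in the `r`-round Ehrenfeucht–Fraïssé game. Ordinary games suffice,
because the number of quantifiers bounds the quantifier rank. Blank intervals of length at least `2
^ r` are equivalent, and a spike lowers the required distance to each end to `2 ^ r - 1`
(`segEquiv_spike`), which is what lets both strings fit into `n` bits.

Upper bound: the sentence says that some `x` carries the bit `w i` and lies at distance at least `i`
from `min` and at least `n - 1 - i` from `max`, which forces `x = i`. Both distances must be tested
by the same quantifiers. A `∀` point bisects two distances joined by "and", since it lies in only
one of the two intervals, and the bisection produces an "or". An `∃` point bisects two distances
joined by "or", since it can choose the disjunct that it witnesses, and the bisection produces an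
"and". So alternating quantifiers each double the reach, up to an additive loss (`DefinesDisj.all`,
`DefinesConj.ex`), and `log n + O(1)` of them suffice. -/

/-! ### Games on intervals. -/

/-- Ehrenfeucht–Fraïssé equivalence with `r` rounds of the open intervals `(i, j)` of `w` and
`(i', j')` of `w'`. -/
def SegEquiv (w w' : ℤ → Bool) : ℕ → ℤ → ℤ → ℤ → ℤ → Prop
  | 0, _, _, _, _ => True
  | r + 1, i, j, i', j' =>
    (∀ m, i < m → m < j → ∃ m', i' < m' ∧ m' < j' ∧ w m = w' m' ∧
      SegEquiv w w' r i m i' m' ∧ SegEquiv w w' r m j m' j') ∧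
    (∀ m', i' < m' → m' < j' → ∃ m, i < m ∧ m < j ∧ w m = w' m' ∧
      SegEquiv w w' r i m i' m' ∧ SegEquiv w w' r m j m' j')

namespace SegEquiv

variable {w w' : ℤ → Bool} {r : ℕ} {i j i' j' : ℤ}

theorem symm (h : SegEquiv w w' r i j i' j') : SegEquiv w' w r i' j' i j := by
  induction r generalizing i j i' j' with
  | zero => trivial
  | succ r ih =>
    refine ⟨fun m h1 h2 => ?_, fun m h1 h2 => ?_⟩
    · obtain ⟨m', a, b, c, d, e⟩ := h.2 m h1 h2
      exact ⟨m', a, b, c.symm, ih d, ih e⟩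
    · obtain ⟨m', a, b, c, d, e⟩ := h.1 m h1 h2
      exact ⟨m', a, b, c.symm, ih d, ih e⟩

theorem of_succ (h : SegEquiv w w' (r + 1) i j i' j') : SegEquiv w w' r i j i' j' := by
  induction r generalizing i j i' j' with
  | zero => trivial
  | succ r ih =>
    refine ⟨fun m h1 h2 => ?_, fun m h1 h2 => ?_⟩
    · obtain ⟨m', a, b, c, d, e⟩ := h.1 m h1 h2
      exact ⟨m', a, b, c, ih d, ih e⟩
    · obtain ⟨m', a, b, c, d, e⟩ := h.2 m h1 h2
      exact ⟨m', a, b, c, ih d, ih e⟩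

/-- Gluing at a common point: a move in one half is answered there, and the other half is reattached
by induction. It supplies the intervals between pebbles that are not adjacent. -/
theorem append {m m' : ℤ} (hm : i < m) (hm2 : m < j) (hm' : i' < m') (hm2' : m' < j')
    (hw : w m = w' m')
    (h1 : SegEquiv w w' r i m i' m') (h2 : SegEquiv w w' r m j m' j') :
    SegEquiv w w' r i j i' j' := by
  induction r generalizing i j i' j' m m' with
  | zero => trivial
  | succ r ih =>
    refine ⟨fun x hx1 hx2 => ?_, fun x' hx1 hx2 => ?_⟩
    · rcases lt_trichotomy x m with hlt | rfl | hlt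
      · obtain ⟨x', a, b, c, d, e⟩ := h1.1 x hx1 hlt
        exact ⟨x', a, b.trans hm2', c, d, ih hlt hm2 b hm2' hw e h2.of_succ⟩
      · exact ⟨m', hm', hm2', hw, h1.of_succ, h2.of_succ⟩
      · obtain ⟨x', a, b, c, d, e⟩ := h2.1 x hlt hx2
        exact ⟨x', hm'.trans a, b, c, ih hm hlt hm' a hw h1.of_succ d, e⟩
    · rcases lt_trichotomy x' m' with hlt | rfl | hlt
      · obtain ⟨x, a, b, c, d, e⟩ := h1.2 x' hx1 hlt
        exact ⟨x, a, b.trans hm2, c, d, ih b hm2 hlt hm2' hw e h2.of_succ⟩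
      · exact ⟨m, hm, hm2, hw, h1.of_succ, h2.of_succ⟩
      · obtain ⟨x, a, b, c, d, e⟩ := h2.2 x' hlt hx2
        exact ⟨x, hm.trans a, b, c, ih hm a hm' hlt hw h1.of_succ d, e⟩

theorem of_reflect
    (h : SegEquiv (fun x => w (-x)) (fun x => w' (-x)) r (-j) (-i) (-j') (-i')) :
    SegEquiv w w' r i j i' j' := by
  induction r generalizing i j i' j' with
  | zero => trivial
  | succ r ih =>
    refine ⟨fun m h1 h2 => ?_, fun m h1 h2 => ?_⟩
    · obtain ⟨m', a, b, c, d, e⟩ := h.1 (-m) (by omega) (by omega)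
      refine ⟨-m', by omega, by omega, by simpa using c, ih ?_, ih ?_⟩ <;> simpa
    · obtain ⟨m', a, b, c, d, e⟩ := h.2 (-m) (by omega) (by omega)
      refine ⟨-m', by omega, by omega, by simpa using c, ih ?_, ih ?_⟩ <;> simpa

/-- A move closer than `2 ^ r` to an end is answered at the same distance from that end. Any other
move is answered at distance `2 ^ r` from the left end, leaving both pieces long. -/
theorem of_blank (hw : ∀ x, i < x → x < j → w x = false)
    (hw' : ∀ x, i' < x → x < j' → w' x = false)
    (h : j - i = j' - i' ∨ (2 ^ r ≤ j - i ∧ 2 ^ r ≤ j' - i')) :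
    SegEquiv w w' r i j i' j' := by
  induction r generalizing i j i' j' with
  | zero => trivial
  | succ r ih =>
    have pos : (0 : ℤ) < 2 ^ r := by positivity
    rw [pow_succ] at h
    set T : ℤ := 2 ^ r
    have resp : ∀ a b a' b' m : ℤ, (b - a = b' - a' ∨ (T * 2 ≤ b - a ∧ T * 2 ≤ b' - a')) →
        a < m → m < b → ∃ m', a' < m' ∧ m' < b' ∧
          (m - a = m' - a' ∨ (T ≤ m - a ∧ T ≤ m' - a')) ∧
          (b - m = b' - m' ∨ (T ≤ b - m ∧ T ≤ b' - m')) := by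
      intro a b a' b' m hab h1 h2
      rcases lt_or_ge (m - a) T with h3 | h3
      · exact ⟨a' + (m - a), by omega, by omega, by omega, by omega⟩
      · rcases lt_or_ge (b - m) T with h4 | h4
        · exact ⟨b' - (b - m), by omega, by omega, by omega, by omega⟩
        · exact ⟨a' + T, by omega, by omega, by omega, by omega⟩
    refine ⟨fun m h1 h2 => ?_, fun m h1 h2 => ?_⟩
    · obtain ⟨m', a, b, c, d⟩ := resp i j i' j' m h h1 h2
      refine ⟨m', a, b, by rw [hw m h1 h2, hw' m' a b], ih ?_ ?_ c, ih ?_ ?_ d⟩ <;> intro x _ _ <;>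
        first | exact hw x (by omega) (by omega) | exact hw' x (by omega) (by omega)
    · obtain ⟨m', a, b, c, d⟩ := resp i' j' i j m (by omega) h1 h2
      refine ⟨m', a, b, by rw [hw' m h1 h2, hw m' a b], ih ?_ ?_ (by omega),
        ih ?_ ?_ (by omega)⟩ <;> intro x _ _ <;>
        first | exact hw x (by omega) (by omega) | exact hw' x (by omega) (by omega)

end SegEquiv

/-! ### Intervals containing a single `1`. -/

/-- The two-way infinite string whose only `1` is at position `p`. -/
def spike (p x : ℤ) : Bool := decide (x = p)

theorem spike_self (p : ℤ) : spike p p = true := by simp [spike]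

theorem spike_of_ne {p x : ℤ} (h : x ≠ p) : spike p x = false := by simp [spike, h]

theorem spike_neg (p : ℤ) : (fun x => spike (-p) (-x)) = spike p := by
  funext x; simp [spike]

section Spike

variable {r : ℕ} {p p' i j i' j' : ℤ}

theorem segEquiv_spike_of_aligned (hp : i < p) (hp2 : p < j) (hp' : i' < p') (hp2' : p' < j')
    (hl : p - i = p' - i' ∨ (2 ^ r ≤ p - i ∧ 2 ^ r ≤ p' - i'))
    (hr : j - p = j' - p' ∨ (2 ^ r ≤ j - p ∧ 2 ^ r ≤ j' - p')) :
    SegEquiv (spike p) (spike p') r i j i' j' := by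
  refine SegEquiv.append hp hp2 hp' hp2' (by simp [spike_self]) (.of_blank ?_ ?_ hl)
    (.of_blank ?_ ?_ hr) <;> intro x _ _ <;> exact spike_of_ne (by omega)

theorem segEquiv_spike_left_forth {T : ℤ} (hT : T = 2 ^ r)
    (hl : 2 * T ≤ p - i) (hl' : 2 * T ≤ p' - i')
    (hr : 2 * T - 1 ≤ j - p) (hr' : 2 * T - 1 ≤ j' - p') {m : ℤ} (hm : i < m) (hm2 : m ≤ p) :
    ∃ m', i' < m' ∧ m' ≤ p' ∧ spike p m = spike p' m' ∧
      SegEquiv (spike p) (spike p') r i m i' m' ∧ SegEquiv (spike p) (spike p') r m j m' j' := by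
  have pos : 0 < T := by rw [hT]; positivity
  rcases hm2.eq_or_lt with rfl | hm2
  · refine ⟨p', by omega, by omega, by simp [spike_self], .of_blank ?_ ?_ ?_, .of_blank ?_ ?_ ?_⟩
    · intro x _ _; exact spike_of_ne (by omega)
    · intro x _ _; exact spike_of_ne (by omega)
    · omega
    · intro x _ _; exact spike_of_ne (by omega)
    · intro x _ _; exact spike_of_ne (by omega)
    · omega
  have key : ∃ m', i' < m' ∧ m' < p' ∧
      (m - i = m' - i' ∨ (T ≤ m - i ∧ T ≤ m' - i')) ∧
      (p - m = p' - m' ∨ (T ≤ p - m ∧ T ≤ p' - m')) := by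
    rcases lt_or_ge (m - i) T with h3 | h3
    · exact ⟨i' + (m - i), by omega, by omega, by omega, by omega⟩
    · rcases lt_or_ge (p - m) T with h4 | h4
      · exact ⟨p' - (p - m), by omega, by omega, by omega, by omega⟩
      · exact ⟨i' + T, by omega, by omega, by omega, by omega⟩
  obtain ⟨m', a, b, c, d⟩ := key
  refine ⟨m', a, b.le, by rw [spike_of_ne (by omega), spike_of_ne (by omega)],
    .of_blank ?_ ?_ (hT ▸ c), segEquiv_spike_of_aligned hm2 (by omega) b (by omega) (hT ▸ d) ?_⟩
  · intro x _ _; exact spike_of_ne (by omega)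
  · intro x _ _; exact spike_of_ne (by omega)
  · omega

/-- A move on the side of the spike that is one position too short. -/
theorem segEquiv_spike_short_forth {T : ℤ} (hT : T = 2 ^ r)
    (hl : 2 * T - 1 ≤ p - i) (hl' : 2 * T - 1 ≤ p' - i')
    (hr : 2 * T - 1 ≤ j - p) (hr' : 2 * T - 1 ≤ j' - p') {m : ℤ} (hm : p < m) (hm2 : m < j)
    (hT2 : 2 ≤ T)
    (ih : ∀ {i j i' j' : ℤ}, T ≤ p - i → T ≤ p' - i' → T - 1 ≤ j - p → T - 1 ≤ j' - p' →
      SegEquiv (spike p) (spike p') r i j i' j') :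
    ∃ m', p' < m' ∧ m' < j' ∧ spike p m = spike p' m' ∧
      SegEquiv (spike p) (spike p') r i m i' m' ∧ SegEquiv (spike p) (spike p') r m j m' j' := by
  -- A gap below `T - 1` is copied exactly; a blank tail longer than `T` remains on both sides.
  rcases lt_or_ge (m - p) (T - 1) with h3 | h3
  · refine ⟨p' + (m - p), by omega, by omega,
      by rw [spike_of_ne (by omega), spike_of_ne (by omega)],
      segEquiv_spike_of_aligned (by omega) hm (by omega) (by omega) ?_ ?_, .of_blank ?_ ?_ ?_⟩
    · omega
    · omega
    · intro x _ _; exact spike_of_ne (by omega)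
    · intro x _ _; exact spike_of_ne (by omega)
    · omega
  -- Now the piece keeping the spike goes to `ih`, which tolerates a right gap of `T - 1`. Since `2
  -- * T - 1 = (T - 1) + T`, this leaves room for a blank tail of length `T`; this is where the
  -- spike saves one position.
  · rcases lt_or_ge (j - m) T with h4 | h4
    · refine ⟨j' - (j - m), by omega, by omega,
        by rw [spike_of_ne (by omega), spike_of_ne (by omega)],
        ih (by omega) (by omega) (by omega) (by omega), .of_blank ?_ ?_ ?_⟩
      · intro x _ _; exact spike_of_ne (by omega)
      · intro x _ _; exact spike_of_ne (by omega)
      · omega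
    · refine ⟨j' - T, by omega, by omega,
        by rw [spike_of_ne (by omega), spike_of_ne (by omega)],
        ih (by omega) (by omega) (by omega) (by omega), .of_blank ?_ ?_ ?_⟩
      · intro x _ _; exact spike_of_ne (by omega)
      · intro x _ _; exact spike_of_ne (by omega)
      · omega

/-- Only the right side is one short. The induction starts at `r = 1`, where a round needs just one
spike and one blank inside each interval; the left gap of 2 provides the blank. -/
theorem segEquiv_spike_left (hr0 : 1 ≤ r) (hl : 2 ^ r ≤ p - i) (hl' : 2 ^ r ≤ p' - i')
    (hr : 2 ^ r - 1 ≤ j - p) (hr' : 2 ^ r - 1 ≤ j' - p') :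
    SegEquiv (spike p) (spike p') r i j i' j' := by
  induction r, hr0 using Nat.le_induction generalizing p p' i j i' j' with
  | base =>
    have aux : ∀ {p p' i j i' j' : ℤ}, 2 ≤ p' - i' → 1 ≤ j' - p' → ∀ m, i < m → m < j →
        ∃ m', i' < m' ∧ m' < j' ∧ spike p m = spike p' m' := by
      intro p p' i j i' j' h1 h2 m _ _
      by_cases h : m = p
      · exact ⟨p', by omega, by omega, by rw [h, spike_self, spike_self]⟩
      · exact ⟨i' + 1, by omega, by omega, by rw [spike_of_ne h, spike_of_ne (by omega)]⟩
    norm_num at hl hl' hr hr'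
    refine ⟨fun m h1 h2 => ?_, fun m h1 h2 => ?_⟩
    · obtain ⟨m', a, b, c⟩ := aux (p := p) hl' (by omega) m h1 h2
      exact ⟨m', a, b, c, trivial, trivial⟩
    · obtain ⟨m', a, b, c⟩ := aux (p := p') hl (by omega) m h1 h2
      exact ⟨m', a, b, c.symm, trivial, trivial⟩
  | succ r hr1 ih =>
    have hT2 : (2 : ℤ) ≤ 2 ^ r := by
      calc (2 : ℤ) = 2 ^ 1 := by norm_num
        _ ≤ 2 ^ r := pow_le_pow_right₀ (by norm_num) hr1
    rw [pow_succ] at hl hl' hr hr'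
    refine ⟨fun m h1 h2 => ?_, fun m h1 h2 => ?_⟩
    · rcases le_or_gt m p with h | h
      · obtain ⟨m', a, b, c, d, e⟩ := segEquiv_spike_left_forth (r := r) (p := p) (p' := p') (i := i) (j := j)
          (i' := i') (j' := j') rfl (by omega) (by omega) (by omega) (by omega) h1 h
        exact ⟨m', a, by omega, c, d, e⟩
      · obtain ⟨m', a, b, c, d, e⟩ := segEquiv_spike_short_forth (p := p) (p' := p') (i := i)
          (i' := i') (j' := j') rfl (by omega) (by omega) (by omega) (by omega) h h2 hT2 ih
        exact ⟨m', by omega, b, c, d, e⟩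
    · rcases le_or_gt m p' with h | h
      · obtain ⟨m', a, b, c, d, e⟩ := segEquiv_spike_left_forth (r := r) (p := p') (p' := p) (i := i')
          (j := j') (i' := i) (j' := j) rfl (by omega) (by omega) (by omega) (by omega) h1 h
        exact ⟨m', a, by omega, c.symm, d.symm, e.symm⟩
      · obtain ⟨m', a, b, c, d, e⟩ := segEquiv_spike_short_forth (p := p') (p' := p) (i := i')
          (i' := i) (j' := j) rfl (by omega) (by omega) (by omega) (by omega) h h2 hT2 ih
        exact ⟨m', by omega, b, c.symm, d.symm, e.symm⟩

/-- After a move beside the spike, the untouched side still has gap at least `2 ^ r - 1 ≥ 2 ^ (r -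
1)`, so the one-sided version takes over. For `r = 1` both gaps could be 1, leaving no blank to
play. -/
theorem segEquiv_spike (hr0 : 2 ≤ r) (hl : 2 ^ r - 1 ≤ p - i) (hl' : 2 ^ r - 1 ≤ p' - i')
    (hr : 2 ^ r - 1 ≤ j - p) (hr' : 2 ^ r - 1 ≤ j' - p') :
    SegEquiv (spike p) (spike p') r i j i' j' := by
  obtain ⟨r, rfl⟩ := Nat.exists_eq_add_of_le' (Nat.le_of_succ_le hr0)
  have hr1 : 1 ≤ r := by omega
  have hT2 : (2 : ℤ) ≤ 2 ^ r := by
    calc (2 : ℤ) = 2 ^ 1 := by norm_num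
      _ ≤ 2 ^ r := pow_le_pow_right₀ (by norm_num) hr1
  rw [pow_succ] at hl hl' hr hr'
  have forth : ∀ {p p' i j i' j' : ℤ}, 2 ^ r * 2 - 1 ≤ p - i → 2 ^ r * 2 - 1 ≤ p' - i' →
      2 ^ r * 2 - 1 ≤ j - p → 2 ^ r * 2 - 1 ≤ j' - p' → ∀ m, p < m → m < j →
      ∃ m', p' < m' ∧ m' < j' ∧ spike p m = spike p' m' ∧
      SegEquiv (spike p) (spike p') r i m i' m' ∧ SegEquiv (spike p) (spike p') r m j m' j' := by
    intro p p' i j i' j' hl hl' hr hr' m h h2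
    exact segEquiv_spike_short_forth rfl (by omega) (by omega) (by omega) (by omega) h h2 hT2
      (segEquiv_spike_left hr1)
  have full : ∀ {p p' i j i' j' : ℤ}, 2 ^ r * 2 - 1 ≤ p - i → 2 ^ r * 2 - 1 ≤ p' - i' →
      2 ^ r * 2 - 1 ≤ j - p → 2 ^ r * 2 - 1 ≤ j' - p' → ∀ m, i < m → m < j →
      ∃ m', i' < m' ∧ m' < j' ∧ spike p m = spike p' m' ∧
      SegEquiv (spike p) (spike p') r i m i' m' ∧ SegEquiv (spike p) (spike p') r m j m' j' := by
    intro p p' i j i' j' hl hl' hr hr' m h1 h2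
    rcases lt_trichotomy m p with h | rfl | h
    -- A move to the left of the spike is the mirror image of one to the right.
    · obtain ⟨m', a, b, c, d, e⟩ := forth (p := -p) (p' := -p') (i := -j) (j := -i) (i' := -j')
        (j' := -i') (by omega) (by omega) (by omega) (by omega) (-m) (by omega) (by omega)
      refine ⟨-m', by omega, by omega, ?_, ?_, ?_⟩
      · rw [← spike_neg p, ← spike_neg p']; simpa using c
      · rw [← spike_neg p, ← spike_neg p']
        exact SegEquiv.of_reflect (by simpa using e)
      · rw [← spike_neg p, ← spike_neg p']
        exact SegEquiv.of_reflect (by simpa using d)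
    · refine ⟨p', by omega, by omega, by simp [spike_self], .of_blank ?_ ?_ ?_, .of_blank ?_ ?_ ?_⟩
      · intro x _ _; exact spike_of_ne (by omega)
      · intro x _ _; exact spike_of_ne (by omega)
      · omega
      · intro x _ _; exact spike_of_ne (by omega)
      · intro x _ _; exact spike_of_ne (by omega)
      · omega
    · obtain ⟨m', a, b, c⟩ := forth hl hl' hr hr' m h h2
      exact ⟨m', by omega, b, c⟩
  refine ⟨full hl hl' hr hr', fun m h1 h2 => ?_⟩
  obtain ⟨m', a, b, c, d, e⟩ := full hl' hl hr' hr m h1 h2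
  exact ⟨m', a, b, c.symm, d.symm, e.symm⟩

end Spike

/-! ### From intervals to pebble positions and formulas. -/

/-- The pairs in `P` form a partial isomorphism between `w` and `w'` that can be extended
for `r` more rounds. -/
structure PebbleEquiv (w w' : ℤ → Bool) (r : ℕ) (P : ℤ → ℤ → Prop) : Prop where
  label : ∀ {a a'}, P a a' → w a = w' a'
  lt_iff : ∀ {a a' b b'}, P a a' → P b b' → (a < b ↔ a' < b')
  seg : ∀ {a a' b b'}, P a a' → P b b' → a < b → SegEquiv w w' r a b a' b'

namespace PebbleEquiv

variable {w w' : ℤ → Bool} {r : ℕ} {P P₂ : ℤ → ℤ → Prop}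

theorem symm (h : PebbleEquiv w w' r P) : PebbleEquiv w' w r (fun a b => P b a) where
  label ha := (h.label ha).symm
  lt_iff ha hb := (h.lt_iff ha hb).symm
  seg ha hb hab := (h.seg ha hb ((h.lt_iff ha hb).2 hab)).symm

theorem mono (h : PebbleEquiv w w' r P) (hP : ∀ a a', P₂ a a' → P a a') :
    PebbleEquiv w w' r P₂ where
  label ha := h.label (hP _ _ ha)
  lt_iff ha hb := h.lt_iff (hP _ _ ha) (hP _ _ hb)
  seg ha hb := h.seg (hP _ _ ha) (hP _ _ hb)

theorem of_succ (h : PebbleEquiv w w' (r + 1) P) : PebbleEquiv w w' r P where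
  label := h.label
  lt_iff := h.lt_iff
  seg ha hb hab := (h.seg ha hb hab).of_succ

theorem eq_iff (h : PebbleEquiv w w' r P) {a a' b b' : ℤ} (ha : P a a') (hb : P b b') :
    a = b ↔ a' = b' := by
  have := h.lt_iff ha hb
  have := h.lt_iff hb ha
  omega

/-- The answer is played between the nearest pebbles `l < x < u`; `SegEquiv.append` then carries the
equivalence to the farther pebbles. -/
theorem forth {N : ℤ} (h : PebbleEquiv w w' (r + 1) P) (h0 : P 0 0) (hN : P N N)
    {x : ℤ} (hx : 0 ≤ x) (hxN : x ≤ N) :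
    ∃ x', 0 ≤ x' ∧ x' ≤ N ∧
      PebbleEquiv w w' r (fun a a' => P a a' ∨ (a = x ∧ a' = x')) := by
  obtain ⟨l, ⟨⟨l', hl⟩, hlx⟩, hmax⟩ := Int.exists_greatest_of_bdd
    (P := fun a => (∃ a', P a a') ∧ a ≤ x) ⟨x, fun z hz => hz.2⟩ ⟨0, ⟨0, h0⟩, hx⟩
  obtain ⟨u, ⟨⟨u', hu⟩, hux⟩, hmin⟩ := Int.exists_least_of_bdd
    (P := fun a => (∃ a', P a a') ∧ x ≤ a) ⟨x, fun z hz => hz.2⟩ ⟨N, ⟨N, hN⟩, hxN⟩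
  have bound : ∀ {a a'}, P a a' → 0 ≤ a → a ≤ N → 0 ≤ a' ∧ a' ≤ N := by
    intro a a' ha h1 h2
    have := h.lt_iff ha h0
    have := h.lt_iff hN ha
    omega
  have hl0 : 0 ≤ l := hmax 0 ⟨⟨0, h0⟩, hx⟩
  have huN : u ≤ N := hmin N ⟨⟨N, hN⟩, hxN⟩
  have old : ∀ {x'}, P x x' → ∃ x', 0 ≤ x' ∧ x' ≤ N ∧
      PebbleEquiv w w' r (fun a a' => P a a' ∨ (a = x ∧ a' = x')) := by
    intro x' hxx
    obtain ⟨h1, h2⟩ := bound hxx hx hxN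
    refine ⟨x', h1, h2, h.of_succ.mono ?_⟩
    rintro a a' (ha | ⟨rfl, rfl⟩)
    exacts [ha, hxx]
  rcases hlx.eq_or_lt with rfl | hlx
  · exact old hl
  rcases hux.eq_or_lt with rfl | hux
  · exact old hu
  have hll := bound hl hl0 (by omega)
  have huu := bound hu (by omega) huN
  obtain ⟨x', h1, h2, hlab, hs1, hs2⟩ := (h.seg hl hu (hlx.trans hux)).1 x hlx hux
  have left : ∀ {a a'}, P a a' → a ≤ l → a' < x' ∧ SegEquiv w w' r a x a' x' := by
    intro a a' ha hal
    rcases hal.eq_or_lt with rfl | hal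
    · obtain rfl := (h.eq_iff ha hl).1 rfl
      exact ⟨h1, hs1⟩
    · have := (h.lt_iff ha hl).1 hal
      exact ⟨this.trans h1, .append hal hlx this h1 (h.label hl) (h.seg ha hl hal).of_succ hs1⟩
  have right : ∀ {a a'}, P a a' → u ≤ a → x' < a' ∧ SegEquiv w w' r x a x' a' := by
    intro a a' ha hal
    rcases hal.eq_or_lt with rfl | hal
    · obtain rfl := (h.eq_iff ha hu).1 rfl
      exact ⟨h2, hs2⟩
    · have := (h.lt_iff hu ha).1 hal
      exact ⟨h2.trans this, .append hux hal h2 this (h.label hu) hs2 (h.seg hu ha hal).of_succ⟩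
  have dich : ∀ {a a'}, P a a' → a ≤ l ∨ u ≤ a := by
    intro a a' ha
    rcases le_total a x with hax | hax
    · exact .inl (hmax a ⟨⟨a', ha⟩, hax⟩)
    · exact .inr (hmin a ⟨⟨a', ha⟩, hax⟩)
  refine ⟨x', by omega, by omega, ?_, ?_, ?_⟩
  · rintro a a' (ha | ⟨rfl, rfl⟩)
    exacts [h.label ha, hlab]
  · rintro a a' b b' (ha | ⟨rfl, rfl⟩) (hb | ⟨rfl, rfl⟩)
    · exact h.lt_iff ha hb
    · rcases dich ha with hd | hd
      · have := (left ha hd).1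
        omega
      · have := (right ha hd).1
        omega
    · rcases dich hb with hd | hd
      · have := (left hb hd).1
        omega
      · have := (right hb hd).1
        omega
    · simp
  · rintro a a' b b' (ha | ⟨rfl, rfl⟩) (hb | ⟨rfl, rfl⟩) hab
    · exact (h.seg ha hb hab).of_succ
    · exact (left ha (by rcases dich ha with hd | hd <;> omega)).2
    · exact (right hb (by rcases dich hb with hd | hd <;> omega)).2
    · omega

end PebbleEquiv

open FirstOrder.Language in
/-- Satisfaction of a formula in the structure of the string `w`. -/
abbrev stringRealize {n : ℕ} [NeZero n] (w : Fin n → Bool) {k : ℕ}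
    (φ : tauString.BoundedFormula Empty k) (v : Fin k → Fin n) : Prop :=
  @BoundedFormula.Realize tauString (Fin n) (stringStructure w) Empty k φ default v

/-- The value of a term in the structure of the string `w`. -/
abbrev stringTermValue {n : ℕ} [NeZero n] (w : Fin n → Bool) {k : ℕ}
    (t : tauString.Term (Empty ⊕ Fin k)) (v : Fin k → Fin n) : Fin n :=
  @FirstOrder.Language.Term.realize tauString (Fin n) (stringStructure w) (Empty ⊕ Fin k)
    (Sum.elim default v) t

/-- The positions marked by the variables and by the two constants in two strings. -/
def pebblePairs {n k : ℕ} (v v' : Fin k → Fin n) (a a' : ℤ) : Prop :=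
  (a = 0 ∧ a' = 0) ∨ (a = n - 1 ∧ a' = n - 1) ∨ ∃ i, a = (v i : ℕ) ∧ a' = (v' i : ℕ)

theorem pebblePairs_termValue {n : ℕ} [NeZero n] (w w' : Fin n → Bool) {k : ℕ}
    (v v' : Fin k → Fin n) (t : tauString.Term (Empty ⊕ Fin k)) :
    pebblePairs v v' (stringTermValue w t v : ℕ) (stringTermValue w' t v' : ℕ) := by
  cases t with
  | var x =>
    rcases x with e | i
    · exact e.elim
    · exact .inr (.inr ⟨i, rfl, rfl⟩)
  | func f ts =>
    have hn := Nat.pos_of_ne_zero (NeZero.ne n)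
    cases f with
    | min => exact .inl ⟨rfl, rfl⟩
    | max =>
      have : ((n - 1 : ℕ) : ℤ) = n - 1 := by omega
      exact .inr (.inl ⟨this, this⟩)

theorem stringRealize_iff_of_pebbleEquiv {n : ℕ} [NeZero n] {w w' : Fin n → Bool}
    {W W' : ℤ → Bool} (hW : ∀ i : Fin n, W (i : ℕ) = w i) (hW' : ∀ i : Fin n, W' (i : ℕ) = w' i)
    {k : ℕ} (φ : tauString.BoundedFormula Empty k) {r : ℕ} (hr : numQuantifiers φ ≤ r)
    {v v' : Fin k → Fin n} (h : PebbleEquiv W W' r (pebblePairs v v')) :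
    stringRealize w φ v ↔ stringRealize w' φ v' := by
  induction φ generalizing r with
  | falsum => exact Iff.rfl
  | equal t₁ t₂ =>
    have := h.eq_iff (pebblePairs_termValue w w' v v' t₁) (pebblePairs_termValue w w' v v' t₂)
    rw [Nat.cast_inj, Nat.cast_inj, ← Fin.ext_iff, ← Fin.ext_iff] at this
    exact this
  | rel R ts =>
    cases R with
    | S =>
      have := h.label (pebblePairs_termValue w w' v v' (ts 0))
      rw [hW, hW'] at this
      change w (stringTermValue w (ts 0) v) = true ↔ w' (stringTermValue w' (ts 0) v') = true
      rw [this]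
    | lt =>
      have := h.lt_iff (pebblePairs_termValue w w' v v' (ts 0))
        (pebblePairs_termValue w w' v v' (ts 1))
      rw [Nat.cast_lt, Nat.cast_lt] at this
      exact this
  | imp φ ψ ihφ ihψ =>
    simp only [numQuantifiers] at hr
    exact imp_congr (ihφ (by omega) h) (ihψ (by omega) h)
  | all φ ih =>
    simp only [numQuantifiers] at hr
    obtain ⟨r, rfl⟩ := Nat.exists_eq_add_of_le' (Nat.le_of_add_left_le hr)
    have snoc : ∀ (x x' : Fin n) (a a' : ℤ),
        pebblePairs (Fin.snoc v x : Fin _ → Fin n) (Fin.snoc v' x') a a' →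
        pebblePairs v v' a a' ∨ (a = (x : ℕ) ∧ a' = (x' : ℕ)) := by
      rintro x x' a a' (hh | hh | ⟨i, hi, hi'⟩)
      · exact .inl (.inl hh)
      · exact .inl (.inr (.inl hh))
      · induction i using Fin.lastCases with
        | last => exact .inr ⟨by simpa using hi, by simpa using hi'⟩
        | cast i => exact .inl (.inr (.inr ⟨i, by simpa using hi, by simpa using hi'⟩))
    constructor
    · intro H x'
      obtain ⟨x, h0, h1, hx⟩ := h.symm.forth (N := n - 1) (.inl ⟨rfl, rfl⟩)
        (.inr (.inl ⟨rfl, rfl⟩)) (x := (x' : ℕ)) (by omega) (by omega)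
      lift x to ℕ using h0
      refine (ih (by omega) (hx.symm.mono fun a a' ha => ?_)).1 (H ⟨x, by omega⟩)
      rcases snoc _ _ _ _ ha with ha | ⟨ha, ha'⟩
      exacts [.inl ha, .inr ⟨ha', ha⟩]
    · intro H x
      obtain ⟨x', h0, h1, hx⟩ := h.forth (N := n - 1) (.inl ⟨rfl, rfl⟩)
        (.inr (.inl ⟨rfl, rfl⟩)) (x := (x : ℕ)) (by omega) (by omega)
      lift x' to ℕ using h0
      exact (ih (by omega) (hx.mono fun a a' ha => snoc _ _ _ _ ha)).2 (H ⟨x', by omega⟩)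

theorem stringSat_iff_realize {n : ℕ} [NeZero n] (w : Fin n → Bool) (φ : tauString.Sentence)
    (v : Fin 0 → Fin n) : StringSat w φ ↔ stringRealize w φ v := by
  unfold StringSat stringRealize FirstOrder.Language.Sentence.Realize
    FirstOrder.Language.Formula.Realize
  refine iff_of_eq ?_
  congr 1 <;> exact Subsingleton.elim _ _

/-! ### The lower bound. -/

theorem exists_hard_pair {n : ℕ} [NeZero n] (hn : 8 ≤ n) :
    ∃ w w' : Fin n → Bool, w ≠ w' ∧ ∀ φ : tauString.Sentence, Separates φ {w} {w'} →
      ⌊Real.logb 2 (n : ℝ)⌋ ≤ (numQuantifiers φ : ℤ) := by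
  have hlog : 3 ≤ Nat.log 2 n := Nat.le_log_of_pow_le (by norm_num) hn
  obtain ⟨r, hr⟩ := Nat.exists_eq_add_of_le' (Nat.le_trans (by norm_num : 1 ≤ 3) hlog)
  have hr2 : 2 ≤ r := by omega
  have hpow : 2 ^ (r + 1) ≤ n := hr ▸ Nat.pow_log_le_self 2 (by omega)
  have h4 : 2 ^ 2 ≤ 2 ^ r := Nat.pow_le_pow_right (by norm_num) hr2
  rw [pow_succ] at hpow
  have hcast : ((2 ^ r : ℕ) : ℤ) = 2 ^ r := by push_cast; rfl
  refine ⟨fun i => spike (2 ^ r - 1) (i : ℕ), fun i => spike (2 ^ r) (i : ℕ), ?_, ?_⟩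
  · intro h
    have := congrFun h ⟨2 ^ r, by omega⟩
    rw [spike_of_ne (by push_cast; omega)] at this
    simp [spike] at this
  · rintro φ ⟨h1, h2⟩
    have hfl : ⌊Real.logb 2 (n : ℝ)⌋ = (r : ℤ) + 1 := by
      have := Real.floor_logb_natCast (b := 2) (r := n) (by positivity)
      rw [Int.log_natCast, hr] at this
      exact_mod_cast this
    rw [hfl]
    by_contra hlt
    refine h2 _ rfl ((stringSat_iff_realize _ _ default).2 ((stringRealize_iff_of_pebbleEquiv (W := spike (2 ^ r - 1)) (W' := spike (2 ^ r))
      (r := r) (v := default) (v' := default) (fun _ => rfl) (fun _ => rfl) φ (by omega) ?_).1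
      ((stringSat_iff_realize _ _ default).1 (h1 _ rfl))))
    -- The tightest gaps are `2 ^ r - 1` on the left of the first spike and `n - 1 - 2 ^ r ≥ 2 ^ r -
    -- 1` on the right of the second.
    have key : SegEquiv (spike (2 ^ r - 1)) (spike (2 ^ r)) r 0 (n - 1) 0 (n - 1) :=
      segEquiv_spike hr2 (by omega) (by omega) (by omega) (by omega)
    refine ⟨?_, ?_, ?_⟩
    · rintro a a' (⟨rfl, rfl⟩ | ⟨rfl, rfl⟩ | ⟨i, _⟩)
      · rw [spike_of_ne (by omega), spike_of_ne (by omega)]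
      · rw [spike_of_ne (by omega), spike_of_ne (by omega)]
      · exact i.elim0
    · rintro a a' b b' (⟨rfl, rfl⟩ | ⟨rfl, rfl⟩ | ⟨i, _⟩) (⟨rfl, rfl⟩ | ⟨rfl, rfl⟩ | ⟨j, _⟩)
      all_goals first | exact Iff.rfl | exact i.elim0 | exact j.elim0
    · rintro a a' b b' (⟨rfl, rfl⟩ | ⟨rfl, rfl⟩ | ⟨i, _⟩) (⟨rfl, rfl⟩ | ⟨rfl, rfl⟩ | ⟨j, _⟩) hab
      all_goals first | exact key | omega | exact i.elim0 | exact j.elim0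

/-! ### Prenex definability with a prescribed prefix. -/

theorem numQuantifiers_eq_zero_of_isQF {L : FirstOrder.Language.{0, 0}} {α : Type} {k : ℕ}
    {φ : L.BoundedFormula α k} (h : φ.IsQF) : numQuantifiers φ = 0 := by
  induction h with
  | falsum => rfl
  | of_isAtomic h => cases h <;> rfl
  | imp _ _ h₁ h₂ => simp [numQuantifiers, h₁, h₂]

theorem HasSignature.numQuantifiers_eq {L : FirstOrder.Language.{0, 0}} {α : Type} {k : ℕ}
    {φ : L.BoundedFormula α k} {Q : List Quantifier} (h : HasSignature φ Q) :
    numQuantifiers φ = Q.length := by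
  induction h with
  | qf h => simpa using numQuantifiers_eq_zero_of_isQF h
  | @ex k φ Q _ ih =>
    change numQuantifiers φ + 0 + 1 + 0 = _
    simp [ih]
  | all _ ih => simp [numQuantifiers, ih]

open FirstOrder.Language

/-- `R` is definable, uniformly over all strings of length `n`, by a prenex formula with
quantifier prefix `Q`. -/
def StringDefinable {n : ℕ} [NeZero n] (Q : List Quantifier) {k : ℕ}
    (R : (Fin n → Bool) → (Fin k → Fin n) → Prop) : Prop :=
  ∃ φ : tauString.BoundedFormula Empty k, HasSignature φ Q ∧ ∀ w v, stringRealize w φ v ↔ R w v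

/-- `t` is the value of a term. -/
def IsStringTerm {n : ℕ} [NeZero n] {k : ℕ} (t : (Fin k → Fin n) → Fin n) : Prop :=
  ∃ τ : tauString.Term (Empty ⊕ Fin k), ∀ w v, stringTermValue w τ v = t v

section Terms

variable {n : ℕ} [NeZero n] {k : ℕ}

theorem isStringTerm_var (i : Fin k) : IsStringTerm (n := n) (fun v => v i) :=
  ⟨.var (.inr i), fun _ _ => rfl⟩

theorem isStringTerm_min :
    IsStringTerm (n := n) (k := k) fun _ => ⟨0, Nat.pos_of_ne_zero (NeZero.ne n)⟩ :=
  ⟨.func (l := 0) (L := tauString) StringFunc.min Fin.elim0, fun _ _ => rfl⟩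

theorem isStringTerm_max :
    IsStringTerm (n := n) (k := k) fun _ => ⟨n - 1, Nat.sub_one_lt (NeZero.ne n)⟩ :=
  ⟨.func (l := 0) (L := tauString) StringFunc.max Fin.elim0, fun _ _ => rfl⟩

theorem IsStringTerm.lift {t : (Fin k → Fin n) → Fin n} (ht : IsStringTerm t) :
    IsStringTerm (fun v : Fin (k + 1) → Fin n => t (Fin.init v)) := by
  obtain ⟨τ, hτ⟩ := ht
  refine ⟨τ.relabel (Sum.map id Fin.castSucc), fun w v => ?_⟩
  refine Eq.trans ?_ (hτ w _)
  let := stringStructure w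
  change Term.realize _ _ = Term.realize _ _
  rw [Term.realize_relabel]
  congr 1
  funext x
  rcases x with e | i
  · exact e.elim
  · rfl

end Terms

namespace StringDefinable

variable {n : ℕ} [NeZero n] {k : ℕ} {Q : List Quantifier}
  {R A B g : (Fin n → Bool) → (Fin k → Fin n) → Prop}

theorem congr (h : StringDefinable Q A) (hAB : ∀ w v, A w v ↔ B w v) : StringDefinable Q B := by
  obtain ⟨φ, h1, h2⟩ := h
  exact ⟨φ, h1, fun w v => (h2 w v).trans (hAB w v)⟩

theorem isQF (h : StringDefinable [] R) :
    ∃ φ : tauString.BoundedFormula Empty k, φ.IsQF ∧ ∀ w v, stringRealize w φ v ↔ R w v := by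
  obtain ⟨φ, ⟨h1⟩, h2⟩ := h
  exact ⟨φ, h1, h2⟩

theorem not (h : StringDefinable [] R) : StringDefinable [] (fun w v => ¬ R w v) := by
  obtain ⟨φ, h1, h2⟩ := h.isQF
  exact ⟨φ.not, .qf h1.not, fun w v => not_congr (h2 w v)⟩

theorem imp (hA : StringDefinable [] A) (hB : StringDefinable [] B) :
    StringDefinable [] (fun w v => A w v → B w v) := by
  obtain ⟨φ, h1, h2⟩ := hA.isQF
  obtain ⟨ψ, h3, h4⟩ := hB.isQF
  exact ⟨φ.imp ψ, .qf (h1.imp h3), fun w v => imp_congr (h2 w v) (h4 w v)⟩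

theorem or (hA : StringDefinable [] A) (hB : StringDefinable [] B) :
    StringDefinable [] (fun w v => A w v ∨ B w v) :=
  (hA.not.imp hB).congr fun _ _ => or_iff_not_imp_left.symm

theorem and (hA : StringDefinable [] A) (hB : StringDefinable [] B) :
    StringDefinable [] (fun w v => A w v ∧ B w v) :=
  (hA.imp hB.not).not.congr fun _ _ => by tauto

theorem ex {R : (Fin n → Bool) → (Fin (k + 1) → Fin n) → Prop} (h : StringDefinable Q R) :
    StringDefinable (.ex :: Q) (fun w v => ∃ x, R w (Fin.snoc v x)) := by
  obtain ⟨φ, h1, h2⟩ := h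
  refine ⟨φ.ex, .ex h1, fun w v => ?_⟩
  let := stringStructure w
  exact BoundedFormula.realize_ex.trans (exists_congr fun x => h2 w _)

theorem all {R : (Fin n → Bool) → (Fin (k + 1) → Fin n) → Prop} (h : StringDefinable Q R) :
    StringDefinable (.all :: Q) (fun w v => ∀ x, R w (Fin.snoc v x)) := by
  obtain ⟨φ, h1, h2⟩ := h
  exact ⟨φ.all, .all h1, fun w v => forall_congr' fun x => h2 w _⟩

theorem lift (h : StringDefinable [] g) :
    StringDefinable [] (fun w (v : Fin (k + 1) → Fin n) => g w (Fin.init v)) := by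
  obtain ⟨φ, h1, h2⟩ := h.isQF
  refine ⟨φ.liftAt 1 k, .qf h1.liftAt, fun w v => ?_⟩
  refine Iff.trans ?_ (h2 w _)
  let := stringStructure w
  exact BoundedFormula.realize_liftAt_one_self

/-- Two formulas with the same prefix share its quantifiers when a quantifier-free guard selects
between them. This is what prevents the case distinctions below from costing quantifiers. -/
theorem ite (hg : StringDefinable [] g) (hA : StringDefinable Q A) (hB : StringDefinable Q B) :
    StringDefinable Q (fun w v => (g w v ∧ A w v) ∨ (¬ g w v ∧ B w v)) := by
  induction Q generalizing k with
  | nil => exact (hg.and hA).or (hg.not.and hB)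
  | cons q Q ih =>
    obtain ⟨φ, h1, h2⟩ := hA
    obtain ⟨ψ, h3, h4⟩ := hB
    cases h1 with
    | @ex _ φ _ h1 =>
      cases h3 with
      | @ex _ ψ _ h3 =>
        refine (ih hg.lift ⟨φ, h1, fun _ _ => Iff.rfl⟩ ⟨ψ, h3, fun _ _ => Iff.rfl⟩).ex.congr ?_
        intro w v
        rw [← h2, ← h4]
        let := stringStructure w
        change _ ↔ (_ ∧ BoundedFormula.Realize _ _ _) ∨ (_ ∧ BoundedFormula.Realize _ _ _)
        rw [BoundedFormula.realize_ex, BoundedFormula.realize_ex]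
        simp only [Fin.init_snoc, exists_or, exists_and_left]
    | @all _ φ _ h1 =>
      cases h3 with
      | @all _ ψ _ h3 =>
        refine (ih hg.lift ⟨φ, h1, fun _ _ => Iff.rfl⟩ ⟨ψ, h3, fun _ _ => Iff.rfl⟩).all.congr ?_
        intro w v
        rw [← h2, ← h4]
        let := stringStructure w
        change _ ↔ (_ ∧ BoundedFormula.Realize _ _ _) ∨ (_ ∧ BoundedFormula.Realize _ _ _)
        rw [BoundedFormula.realize_all, BoundedFormula.realize_all]
        simp only [Fin.init_snoc]
        by_cases h : g w v <;>
          simp only [h, true_and, not_true_eq_false, false_and, or_false, not_false_eq_true,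
            false_or]

end StringDefinable

section Atomic

variable {n : ℕ} [NeZero n] {k : ℕ} {t t₁ t₂ t₃ : (Fin k → Fin n) → Fin n}

theorem stringDefinable_lt (h₁ : IsStringTerm t₁) (h₂ : IsStringTerm t₂) :
    StringDefinable (n := n) [] (fun _ v => (t₁ v : ℕ) < t₂ v) := by
  obtain ⟨τ₁, h₁⟩ := h₁
  obtain ⟨τ₂, h₂⟩ := h₂
  refine ⟨.rel (L := tauString) (l := 2) StringRel.lt ![τ₁, τ₂],
    .qf (BoundedFormula.IsAtomic.rel _ _).isQF, fun w v => ?_⟩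
  change (stringTermValue w τ₁ v : ℕ) < stringTermValue w τ₂ v ↔ _
  rw [h₁, h₂]

theorem stringDefinable_bit (h : IsStringTerm t) (b : Bool) :
    StringDefinable (n := n) [] (fun w v => w (t v) = b) := by
  have : StringDefinable (n := n) [] (fun w v => w (t v) = true) := by
    obtain ⟨τ, h⟩ := h
    refine ⟨.rel (L := tauString) (l := 1) StringRel.S ![τ],
      .qf (BoundedFormula.IsAtomic.rel _ _).isQF, fun w v => ?_⟩
    change w (stringTermValue w τ v) = true ↔ _
    rw [h]
  cases b
  · exact this.not.congr fun _ _ => by simp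
  · exact this

theorem stringDefinable_add_le (h₁ : IsStringTerm t₁) (h₂ : IsStringTerm t₂) {d : ℕ}
    (hd : d ≤ 1) : StringDefinable (n := n) [] (fun _ v => (t₁ v : ℕ) + d ≤ t₂ v) := by
  interval_cases d
  · exact (stringDefinable_lt h₂ h₁).not.congr fun _ _ => by simp
  · exact stringDefinable_lt h₁ h₂

end Atomic

/-! ### Distances by alternating bisection. -/

/-- Disjunctions of two lower bounds, at most `K`, on distances are definable with prefix `Q`. -/
def DefinesDisj (n : ℕ) [NeZero n] (Q : List Quantifier) (K : ℕ) : Prop :=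
  ∀ ⦃k : ℕ⦄ ⦃t₁ t₂ t₃ : (Fin k → Fin n) → Fin n⦄, IsStringTerm t₁ → IsStringTerm t₂ →
    IsStringTerm t₃ → ∀ ⦃d e : ℕ⦄, d ≤ K → e ≤ K →
    StringDefinable (n := n) Q (fun _ v => (t₁ v : ℕ) + d ≤ t₂ v ∨ (t₂ v : ℕ) + e ≤ t₃ v)

/-- Conjunctions of two lower bounds, at most `K`, on distances are definable with prefix `Q`. -/
def DefinesConj (n : ℕ) [NeZero n] (Q : List Quantifier) (K : ℕ) : Prop :=
  ∀ ⦃k : ℕ⦄ ⦃t₁ t₂ t₃ : (Fin k → Fin n) → Fin n⦄, IsStringTerm t₁ → IsStringTerm t₂ →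
    IsStringTerm t₃ → ∀ ⦃d e : ℕ⦄, d ≤ K → e ≤ K →
    StringDefinable (n := n) Q (fun _ v => (t₁ v : ℕ) + d ≤ t₂ v ∧ (t₂ v : ℕ) + e ≤ t₃ v)

/-- Bisection of a distance by a universally quantified point. -/
theorem exists_forall_bisection {K d : ℕ} (hd : d ≤ 2 * K - 1) :
    ∃ d₁ d₂, d₁ ≤ K ∧ d₂ ≤ K ∧ ∀ {n : ℕ} (a b : Fin n), (a : ℕ) + d ≤ b ↔
      (a : ℕ) + min d 1 ≤ b ∧
        ∀ x : Fin n, a < x ∧ x ≤ b → (a : ℕ) + d₁ ≤ x ∨ (x : ℕ) + d₂ ≤ b := by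
  rcases le_or_gt d 1 with h | h
  · refine ⟨0, 0, by omega, by omega, fun a b => ?_⟩
    rw [min_eq_left h]
    refine ⟨fun h => ⟨h, fun x hx => .inl hx.1.le⟩, And.left⟩
  -- The two halves sum to `d + 1`: a point failing both exists exactly when the positive distance
  -- is at most `(d₁ - 1) + (d₂ - 1) = d - 1`. Hence the bound `2 * K - 1`.
  · refine ⟨(d + 2) / 2, (d + 1) / 2, by omega, by omega, fun a b => ⟨fun h => ?_, fun h => ?_⟩⟩
    · refine ⟨by omega, fun x hx => ?_⟩
      omega
    · obtain ⟨h0, h⟩ := h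
      by_contra hlt
      have := h ⟨max (a + 1) (b + 1 - (d + 1) / 2), by omega⟩
        ⟨Fin.lt_def.2 (by dsimp only; omega), Fin.le_def.2 (by dsimp only; omega)⟩
      dsimp only at this
      omega

/-- The half-open intervals `(t₁, t₂]` and `(t₂, t₃]` are disjoint, so one universal point tests
both distances, and the guards pick the disjunction to check. -/
theorem DefinesDisj.all {n : ℕ} [NeZero n] {Q : List Quantifier} {K : ℕ} (hK : 1 ≤ K)
    (h : DefinesDisj n Q K) : DefinesConj n (.all :: Q) (2 * K - 1) := by
  intro k t₁ t₂ t₃ h₁ h₂ h₃ d e hd he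
  obtain ⟨d₁, d₂, hd₁, hd₂, hd⟩ := exists_forall_bisection hd
  obtain ⟨e₁, e₂, he₁, he₂, he⟩ := exists_forall_bisection he
  have hx : IsStringTerm (n := n) (fun v => v (Fin.last k)) := isStringTerm_var _
  -- Truth and falsity, written with prefix `Q` so that `ite` applies.
  have hT := h hx hx hx (d := 0) (e := 0) (by omega) (by omega)
  have hF := h hx hx hx hK hK
  have guard := ((stringDefinable_add_le h₁ h₂ (min_le_right d 1)).and
    (stringDefinable_add_le h₂ h₃ (min_le_right e 1))).lift
  have first := (stringDefinable_lt h₁.lift hx).and (stringDefinable_lt h₂.lift hx).not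
  have second := (stringDefinable_lt h₂.lift hx).and (stringDefinable_lt h₃.lift hx).not
  refine (guard.ite (first.ite (h h₁.lift hx h₂.lift hd₁ hd₂)
    (second.ite (h h₂.lift hx h₃.lift he₁ he₂) hT)) hF).all.congr fun w v => ?_
  simp only [Fin.init_snoc, Fin.snoc_last]
  rw [hd, he]
  have h1 : ∀ x : Fin n, ((x : ℕ) + 0 ≤ x ∨ (x : ℕ) + 0 ≤ x) ↔ True := by simp
  have h2 : ∀ x : Fin n, ((x : ℕ) + 1 ≤ x ∨ (x : ℕ) + 1 ≤ x) ↔ False := by simp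
  simp only [h1, h2, and_true, and_false, or_false]
  constructor
  · intro H
    refine ⟨⟨(H (t₁ v)).1.1, fun x hx => ?_⟩, (H (t₁ v)).1.2, fun x hx => ?_⟩
    · have := (H x).2
      simp only [Fin.lt_def, Fin.le_def] at hx
      omega
    · have := (H x).2
      simp only [Fin.lt_def, Fin.le_def] at hx
      omega
  · rintro ⟨⟨g1, H1⟩, g2, H2⟩ x
    have H1 := H1 x
    have H2 := H2 x
    simp only [Fin.lt_def, Fin.le_def] at H1 H2
    refine ⟨⟨g1, g2⟩, ?_⟩
    omega

/-- The side of `t₂` on which the witness lies tells which disjunct it bisects. This needs `1 ≤ e`,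
so that the midpoint of the second distance lies strictly to the right of `t₂`. -/
theorem DefinesConj.ex {n : ℕ} [NeZero n] {Q : List Quantifier} {K : ℕ} (hK : 1 ≤ K)
    (h : DefinesConj n Q K) : DefinesDisj n (.ex :: Q) (2 * K) := by
  have pos : ∀ {k : ℕ} {t₁ t₂ t₃ : (Fin k → Fin n) → Fin n}, IsStringTerm t₁ → IsStringTerm t₂ →
      IsStringTerm t₃ → ∀ {d e : ℕ}, d ≤ 2 * K → e ≤ 2 * K → 1 ≤ e → StringDefinable (n := n)
        (.ex :: Q) (fun _ v => (t₁ v : ℕ) + d ≤ t₂ v ∨ (t₂ v : ℕ) + e ≤ t₃ v) := by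
    intro k t₁ t₂ t₃ h₁ h₂ h₃ d e hd he he1
    have hx : IsStringTerm (n := n) (fun v => v (Fin.last k)) := isStringTerm_var _
    refine ((stringDefinable_lt h₂.lift hx).ite
      (h h₂.lift hx h₃.lift (d := (e + 1) / 2) (e := e / 2) (by omega) (by omega))
      (h h₁.lift hx h₂.lift (d := (d + 1) / 2) (e := d / 2) (by omega) (by omega))).ex.congr
      fun w v => ?_
    simp only [Fin.init_snoc, Fin.snoc_last]
    constructor
    · rintro ⟨x, hx⟩
      omega
    · rintro (H | H)
      · exact ⟨⟨t₁ v + (d + 1) / 2, by omega⟩, by dsimp only; omega⟩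
      · exact ⟨⟨t₂ v + (e + 1) / 2, by omega⟩, by dsimp only; omega⟩
  intro k t₁ t₂ t₃ h₁ h₂ h₃ d e hd he
  rcases Nat.eq_zero_or_pos e with rfl | he1
  -- For `e = 0` the second disjunct is quantifier-free. If it fails, so does its version with `e =
  -- 1`, which may replace it; otherwise a tautology with the same prefix is used.
  · refine ((stringDefinable_lt h₃ h₂).ite (pos h₁ h₂ h₃ hd (e := 1) (by omega) le_rfl)
      (pos h₁ h₁ h₁ (d := 0) (e := 1) (by omega) (by omega) le_rfl)).congr fun w v => ?_
    omega
  · exact pos h₁ h₂ h₃ hd he he1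

/-- The prefix `∃∀∃∀…∃∀` with `m` blocks `∃∀`. -/
def exAllPrefix : ℕ → List Quantifier
  | 0 => []
  | m + 1 => .ex :: .all :: exAllPrefix m

theorem length_exAllPrefix (m : ℕ) : (exAllPrefix m).length = 2 * m := by
  induction m with
  | zero => rfl
  | succ m ih => simp [exAllPrefix, ih]; ring

theorem alternatingEndingInForall_exAllPrefix (m : ℕ) :
    AlternatingEndingInForall (exAllPrefix (m + 1)) := by
  induction m with
  | zero => simp [exAllPrefix, AlternatingEndingInForall]
  | succ m ih =>
    have e : exAllPrefix (m + 2) = .ex :: .all :: .ex :: .all :: exAllPrefix m := rfl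
    rw [AlternatingEndingInForall] at ih ⊢
    rw [e]
    rw [show exAllPrefix (m + 1) = .ex :: .all :: exAllPrefix m from rfl] at ih
    exact ⟨.cons_cons (by simp) (.cons_cons (by simp) ih.1), by simpa using ih.2⟩

/-- Each block `∃∀` turns `K` into `4 * K - 2`, and the inequality is exact along this recursion
from `K = 1`. -/
theorem exists_definesDisj (n : ℕ) [NeZero n] (m : ℕ) :
    ∃ K, 4 ^ m + 2 ≤ 3 * K ∧ DefinesDisj n (exAllPrefix m) K := by
  induction m with
  | zero =>
    exact ⟨1, by norm_num, fun _ _ _ _ h₁ h₂ h₃ _ _ hd he =>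
      (stringDefinable_add_le h₁ h₂ hd).or (stringDefinable_add_le h₂ h₃ he)⟩
  | succ m ih =>
    obtain ⟨K, hK, h⟩ := ih
    have : 0 < 4 ^ m := by positivity
    exact ⟨2 * (2 * K - 1), by rw [pow_succ]; omega,
      (h.all (by omega)).ex (by omega)⟩

theorem exists_separating_exAll {n : ℕ} [NeZero n] {w w' : Fin n → Bool} (hw : w ≠ w') {m : ℕ}
    (hm : 2 * n ≤ 4 ^ m) :
    ∃ φ : tauString.Sentence, Separates φ {w} {w'} ∧ HasSignature φ (exAllPrefix (m + 1)) := by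
  obtain ⟨i, hi⟩ := Function.ne_iff.1 hw
  obtain ⟨K, hK, h⟩ := exists_definesDisj n m
  have hn := Nat.pos_of_ne_zero (NeZero.ne n)
  have hc := h.all (by omega)
  have hx : IsStringTerm (n := n) (fun v : Fin 1 → Fin n => v 0) := isStringTerm_var _
  obtain ⟨φ, h1, h2⟩ := ((stringDefinable_bit hx (w i)).ite
    (hc isStringTerm_min hx isStringTerm_max (d := i) (e := n - 1 - i) (by omega) (by omega))
    -- A contradiction, with the prefix of the other branch.
    (hc hx hx hx (d := 1) (e := 1) (by omega) (by omega))).ex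
  refine ⟨φ, ⟨?_, ?_⟩, h1⟩
  · rintro _ rfl
    refine (stringSat_iff_realize _ _ default).2 ((h2 _ default).2 ⟨i, .inl ?_⟩)
    simp [Fin.snoc]
    omega
  · rintro _ rfl hsat
    obtain ⟨x, hx⟩ := (h2 _ default).1 ((stringSat_iff_realize _ _ default).1 hsat)
    simp only [Fin.snoc] at hx
    rcases hx with ⟨hb, hx1, hx2⟩ | ⟨-, hx, -⟩
    · have : x = i := by
        simp at hx1 hx2
        omega
      subst this
      exact hi (by simpa using hb.symm)
    · simp at hx

theorem exists_separating_alternating {n : ℕ} [NeZero n] {w w' : Fin n → Bool} (hw : w ≠ w') :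
    ∃ (φ : tauString.Sentence) (Q : List Quantifier), Separates φ {w} {w'} ∧
      (numQuantifiers φ : ℝ) ≤ Real.logb 2 (n : ℝ) + 5 ∧
      HasSignature φ Q ∧ AlternatingEndingInForall Q := by
  have hn := Nat.pos_of_ne_zero (NeZero.ne n)
  -- From `4 ^ (m - 1) < 2 * n` follows `2 * (m + 1) ≤ log n + 5`.
  set m := Nat.clog 4 (2 * n)
  obtain ⟨φ, h1, h2⟩ := exists_separating_exAll hw (m := m) (Nat.le_pow_clog (by norm_num) _)
  refine ⟨φ, _, h1, ?_, h2, alternatingEndingInForall_exAllPrefix m⟩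
  rw [h2.numQuantifiers_eq, length_exAllPrefix]
  have hm : 0 < m := Nat.clog_pos (by norm_num) (by omega)
  have hlt : 4 ^ (m - 1) < 2 * n := Nat.pow_pred_clog_lt_self (by norm_num) (by omega)
  obtain ⟨l, hl⟩ := Nat.exists_eq_add_of_le' hm
  rw [hl] at hlt ⊢
  have hle : (2 : ℝ) ^ ((2 * l : ℕ) : ℝ) ≤ 2 * n := by
    rw [Real.rpow_natCast, pow_mul]
    exact_mod_cast hlt.le
  have hlog := (Real.le_logb_iff_rpow_le (by norm_num) (by positivity)).2 hle
  rw [Real.logb_mul (by norm_num) (by positivity), Real.logb_self_eq_one (by norm_num)] at hlog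
  push_cast at hlog ⊢
  linarith

theorem proposition1 :
    (∃ C : ℝ, ∀ (n : ℕ) [NeZero n] (w w' : Fin n → Bool), w ≠ w' →
      ∃ (φ : tauString.Sentence) (Q : List Quantifier),
        Separates φ {w} {w'} ∧
        (numQuantifiers φ : ℝ) ≤ Real.logb 2 (n : ℝ) + C ∧
        HasSignature φ Q ∧
        AlternatingEndingInForall Q) ∧
    (∃ N : ℕ, ∀ (n : ℕ) [NeZero n], N ≤ n →
      ∃ w w' : Fin n → Bool, w ≠ w' ∧
        ∀ φ : tauString.Sentence, Separates φ {w} {w'} →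
          ⌊Real.logb 2 (n : ℝ)⌋ ≤ (numQuantifiers φ : ℤ)) :=
  ⟨⟨5, fun _ _ _ _ hw => exists_separating_alternating hw⟩,
    ⟨8, fun _ _ hn => exists_hard_pair hn⟩⟩
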